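/- A skew brace is a set $B$ with two (not necessarily abelian) group structures $(B,+)$ and $(B,\circ)$ such that $a\circ(b+c)=a\circ b-a+a\circ c$ for all $a,b,c\in B$. Put $\lambda_a(b)=-a+a\circ b$ and $a\ast b=\lambda_a(b)-b$; then $\lambda$ is a homomorphism from $(B,\circ)$ to $\operatorname{Aut}(B,+)$. A sub-skew brace is a subset that is a subgroup of both groups; it is finitely generated if it is the smallest sub-skew brace containing some finite set. An ideal is a subgroup of $(B,+)$ that is invariant under all $\lambda_a$ and normal in both $(B,+)$ and $(B,\circ)$; it is a finitely generated ideal if it is the smallest ideal containing some finite set. An ideal $I$ of $B$ is good if every finitely generated ideal $J$ of $B$ with $J\subseteq I$ is finitely generated as a skew brace, and $B$ is good if it is a good ideal of itself. $B$ has property (S) if for every $x\in B$ the subgroup $\{b: x\ast b=0\}\cap C_{(B,+)}(x)$ has finite index in $(B,+)$ and the subgroup $\{b: b\ast x=0\}\cap C_{(B,\circ)}(x)$ has finite index in $(B,\circ)$. The annihilator of $B$ is the ideal $\operatorname{Ann}(B)=\ker\lambda\cap Z(B,+)\cap Z(B,\circ)$. The upper annihilator series is given by $\operatorname{Ann}_0(B)=\{0\}$,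 $\operatorname{Ann}_{\alpha+1}(B)/\operatorname{Ann}_\alpha(B)=\operatorname{Ann}(B/\operatorname{Ann}_\alpha(B))$ for every ordinal $\alpha$, and $\operatorname{Ann}_\mu(B)=\bigcup_{\gamma<\mu}\operatorname{Ann}_\gamma(B)$ for limit ordinals $\mu$. Its last term, i.e. $\operatorname{Ann}_\alpha(B)$ for the least $\alpha$ with $\operatorname{Ann}_\alpha(B)=\operatorname{Ann}_{\alpha+1}(B)$, is the hyper-annihilator $\overline{\operatorname{Ann}}(B)$. $B$ is annihilator nilpotent if $B=\operatorname{Ann}_n(B)$ for some integer $n\ge 0$, and locally annihilator-nilpotent if every finitely generated sub-skew brace of $B$ is annihilator nilpotent. **Theorem.** Let $B$ be a skew brace with property (S). (a) For every ideal $I$ of $B$ the following are equivalent: (1) $I$ is good, and $A\cap I\subseteq\overline{\operatorname{Ann}}(A)$ for every finitely generated sub-skew brace $A$ of $B$; (2) $I\subseteq\overline{\operatorname{Ann}}(B)$. (b) If $B$ is good, then $B$ is locally annihilator-nilpotent if and only if $B=\overline{\operatorname{Ann}}(B)$. -/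

import Mathlib

universe u

/-- A skew (left) brace: a set with two group structures, the additive one `(B, +)` and the
multiplicative one `(B, ∘)` (written `*` here; neither is assumed commutative), such that
`a ∘ (b + c) = a ∘ b - a + a ∘ c`. -/
class SkewBrace (B : Type u) extends AddGroup B, Group B where
  skew_distrib : ∀ a b c : B, a * (b + c) = a * b - a + a * c

namespace SkewBrace

section Basic

variable {B : Type u} [SkewBrace B]

theorem skew_mul_zero (a : B) : a * (0 : B) = a := by
  have h := skew_distrib a 0 0
  rw [add_zero, sub_eq_add_neg, add_assoc] at h
  have h2 := left_eq_add.mp h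
  exact (neg_add_eq_zero.mp h2).symm

theorem one_eq_zero : (1 : B) = 0 := by
  have h := skew_mul_zero (1 : B)
  rw [one_mul] at h
  exact h.symm

/-- `λ_a(b) = -a + a ∘ b`. -/
def lam (a b : B) : B := -a + a * b

theorem mul_eq_add_lam (a b : B) : a * b = a + lam a b := by
  simp [lam]

theorem lam_add (a b c : B) : lam a (b + c) = lam a b + lam a c := by
  simp only [lam, skew_distrib, sub_eq_add_neg, add_assoc]

theorem lam_zero (a : B) : lam a 0 = 0 := by
  simp [lam, skew_mul_zero]

theorem lam_neg (a b : B) : lam a (-b) = -lam a b := by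
  rw [eq_neg_iff_add_eq_zero, ← lam_add, neg_add_cancel, lam_zero]

theorem lam_one (b : B) : lam 1 b = b := by
  rw [lam, one_mul, one_eq_zero, neg_zero, zero_add]

theorem lam_mul (a b c : B) : lam (a * b) c = lam a (lam b c) := by
  have h : a * b * c = a * b + lam a (lam b c) := by
    rw [mul_assoc, mul_eq_add_lam b c, skew_distrib, mul_eq_add_lam a (lam b c), sub_eq_add_neg]
    simp only [add_assoc, neg_add_cancel_left]
  rw [lam, h, neg_add_cancel_left]

theorem lam_inv_lam (a b : B) : lam a⁻¹ (lam a b) = b := by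
  rw [← lam_mul, inv_mul_cancel, lam_one]

theorem lam_lam_inv (a b : B) : lam a (lam a⁻¹ b) = b := by
  rw [← lam_mul, mul_inv_cancel, lam_one]

/-- The group homomorphism `λ : (B, ∘) → Aut(B, +)` (Mathlib writes the group `AddAut B`
additively, with composition as addition). -/
def lamHom (B : Type u) [SkewBrace B] : B →* Multiplicative (AddAut B) where
  toFun a := Multiplicative.ofAdd
    { toFun := lam a
      invFun := lam a⁻¹
      left_inv := lam_inv_lam a
      right_inv := lam_lam_inv a
      map_add' := lam_add a }
  map_one' := congrArg Multiplicative.ofAdd (AddEquiv.ext lam_one)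
  map_mul' a b := congrArg Multiplicative.ofAdd (AddEquiv.ext (lam_mul a b))

theorem mem_lamHom_ker {a : B} : a ∈ (lamHom B).ker ↔ ∀ b, lam a b = b := by
  rw [MonoidHom.mem_ker]
  exact ⟨fun h b => DFunLike.congr_fun (congrArg Multiplicative.toAdd h) b,
    fun h => congrArg Multiplicative.ofAdd (AddEquiv.ext h)⟩

/-- The third operation `a ∗ b = λ_a(b) - b = -a + a ∘ b - b`. -/
def starOp (a b : B) : B := lam a b - b

/-- `Fix^r(x) = {b | x ∗ b = 0}`, a subgroup of `(B, +)`. -/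
def fixRight (x : B) : AddSubgroup B where
  carrier := {b | starOp x b = 0}
  zero_mem' := by simp [starOp, lam_zero]
  add_mem' := by
    intro a b ha hb
    simp only [Set.mem_ofPred_eq, starOp, sub_eq_zero] at ha hb ⊢
    rw [lam_add, ha, hb]
  neg_mem' := by
    intro a ha
    simp only [Set.mem_ofPred_eq, starOp, sub_eq_zero] at ha ⊢
    rw [lam_neg, ha]

/-- `Fix^l(x) = {b | b ∗ x = 0}`, a subgroup of `(B, ∘)`. -/
def fixLeft (x : B) : Subgroup B where
  carrier := {b | starOp b x = 0}
  one_mem' := by simp [starOp, lam_one]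
  mul_mem' := by
    intro a b ha hb
    simp only [Set.mem_ofPred_eq, starOp, sub_eq_zero] at ha hb ⊢
    rw [lam_mul, hb, ha]
  inv_mem' := by
    intro a ha
    simp only [Set.mem_ofPred_eq, starOp, sub_eq_zero] at ha ⊢
    conv_lhs => rw [← ha]
    exact lam_inv_lam a x

/-- Property (s) of an element `x`: the indices `|(B, +) : Fix^r(x) ∩ C_x^+|` and
`|(B, ∘) : Fix^l(x) ∩ C_x^∘|` are finite. -/
def ElementPropS (x : B) : Prop :=
  (fixRight x ⊓ AddSubgroup.centralizer {x}).FiniteIndex ∧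
    (fixLeft x ⊓ Subgroup.centralizer {x}).FiniteIndex

end Basic

/-- Property (S) of a skew brace: all its elements have property (s). -/
def PropS (B : Type u) [SkewBrace B] : Prop := ∀ x : B, ElementPropS x

end SkewBrace

open SkewBrace

/-- A sub-skew brace: a subset that is a subgroup of both `(B, +)` and `(B, ∘)`. -/
structure SubSkewBrace (B : Type u) [SkewBrace B] extends AddSubgroup B where
  mul_mem' : ∀ {a b : B}, a ∈ carrier → b ∈ carrier → a * b ∈ carrier
  inv_mem' : ∀ {a : B}, a ∈ carrier → a⁻¹ ∈ carrier

namespace SubSkewBrace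

variable {B : Type u} [SkewBrace B]

instance : SetLike (SubSkewBrace B) B where
  coe S := S.carrier
  coe_injective := by
    rintro ⟨⟨⟨⟨_, _⟩, _⟩, _⟩, _, _⟩ ⟨⟨⟨⟨_, _⟩, _⟩, _⟩, _, _⟩ h
    congr

instance : PartialOrder (SubSkewBrace B) := .ofSetLike (SubSkewBrace B) B

/-- The subgroup of `(B, ∘)` underlying a sub-skew brace. -/
def toSubgroup (A : SubSkewBrace B) : Subgroup B where
  carrier := A.carrier
  one_mem' := by
    rw [one_eq_zero]
    exact A.zero_mem'
  mul_mem' := A.mul_mem'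
  inv_mem' := A.inv_mem'

/-- A sub-skew brace is a skew brace with the restricted operations. -/
instance (A : SubSkewBrace B) : SkewBrace A where
  __ := (inferInstanceAs (AddGroup A.toAddSubgroup) : AddGroup A)
  __ := (inferInstanceAs (Group A.toSubgroup) : Group A)
  skew_distrib a b c := Subtype.ext (skew_distrib (a : B) (b : B) (c : B))

instance : InfSet (SubSkewBrace B) where
  sInf S :=
    { carrier := {x | ∀ A ∈ S, x ∈ A}
      zero_mem' := fun A _ => A.zero_mem'
      add_mem' := fun ha hb A hA => A.add_mem' (ha A hA) (hb A hA)
      neg_mem' := fun ha A hA => A.neg_mem' (ha A hA)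
      mul_mem' := fun ha hb A hA => A.mul_mem' (ha A hA) (hb A hA)
      inv_mem' := fun ha A hA => A.inv_mem' (ha A hA) }

/-- The sub-skew brace generated by `E`: the smallest sub-skew brace containing `E`. -/
def closure (E : Set B) : SubSkewBrace B := sInf {A | E ⊆ (A : Set B)}

/-- A sub-skew brace is finitely generated (as a skew brace) if it is the smallest sub-skew brace
containing some finite set. -/
def FG (A : SubSkewBrace B) : Prop := ∃ E : Set B, E.Finite ∧ closure E = A

end SubSkewBrace

/-- An ideal of a skew brace: a subgroup of `(B, +)` that is `λ`-invariant and normal in `(B, +)`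
and in `(B, ∘)`. -/
structure BraceIdeal (B : Type u) [SkewBrace B] extends AddSubgroup B where
  lam_mem' : ∀ (a : B) {x : B}, x ∈ carrier → lam a x ∈ carrier
  add_conj_mem' : ∀ (a : B) {x : B}, x ∈ carrier → a + x - a ∈ carrier
  mul_conj_mem' : ∀ (a : B) {x : B}, x ∈ carrier → a * x * a⁻¹ ∈ carrier

namespace BraceIdeal

variable {B : Type u} [SkewBrace B]

instance : SetLike (BraceIdeal B) B where
  coe S := S.carrier
  coe_injective := by
    rintro ⟨⟨⟨⟨_, _⟩, _⟩, _⟩, _, _, _⟩ ⟨⟨⟨⟨_, _⟩, _⟩, _⟩, _, _, _⟩ h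
    congr

instance : PartialOrder (BraceIdeal B) := .ofSetLike (BraceIdeal B) B

/-- An ideal is a sub-skew brace. -/
def toSubSkewBrace (I : BraceIdeal B) : SubSkewBrace B where
  toAddSubgroup := I.toAddSubgroup
  mul_mem' := by
    intro a b ha hb
    rw [mul_eq_add_lam]
    exact I.add_mem' ha (I.lam_mem' a hb)
  inv_mem' := by
    intro a ha
    have h : a⁻¹ = lam a⁻¹ (-a) := by
      rw [lam_neg, lam, inv_mul_cancel, one_eq_zero, add_zero, neg_neg]
    rw [h]
    exact I.lam_mem' _ (I.neg_mem' ha)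

instance : InfSet (BraceIdeal B) where
  sInf S :=
    { carrier := {x | ∀ I ∈ S, x ∈ I}
      zero_mem' := fun I _ => I.zero_mem'
      add_mem' := fun ha hb I hI => I.add_mem' (ha I hI) (hb I hI)
      neg_mem' := fun ha I hI => I.neg_mem' (ha I hI)
      lam_mem' := fun a _ hx I hI => I.lam_mem' a (hx I hI)
      add_conj_mem' := fun a _ hx I hI => I.add_conj_mem' a (hx I hI)
      mul_conj_mem' := fun a _ hx I hI => I.mul_conj_mem' a (hx I hI) }

/-- The ideal of `B` generated by `E`: the smallest ideal containing `E`. -/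
def closure (E : Set B) : BraceIdeal B := sInf {I | E ⊆ (I : Set B)}

/-- The whole skew brace as an ideal. -/
instance : Top (BraceIdeal B) where
  top :=
    { toAddSubgroup := ⊤
      lam_mem' := fun _ _ _ => trivial
      add_conj_mem' := fun _ _ _ => trivial
      mul_conj_mem' := fun _ _ _ => trivial }

/-- The zero ideal. -/
instance : Bot (BraceIdeal B) where
  bot :=
    { toAddSubgroup := ⊥
      lam_mem' := by
        rintro a x (rfl : x = 0)
        exact lam_zero a
      add_conj_mem' := by
        rintro a x (rfl : x = 0)
        change a + 0 - a = 0
        simp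
      mul_conj_mem' := by
        rintro a x (rfl : x = 0)
        change a * 0 * a⁻¹ = 0
        rw [skew_mul_zero, mul_inv_cancel, one_eq_zero] }

/-- `J` is a finitely generated ideal of `B` (finitely generated as an ideal). -/
def IdealFG (J : BraceIdeal B) : Prop := ∃ E : Set B, E.Finite ∧ closure E = J

/-- An ideal `I` of `B` is good if every finitely generated ideal `J` of `B` with `J ⊆ I` is
finitely generated as a skew brace. -/
def IsGood (I : BraceIdeal B) : Prop :=
  ∀ J : BraceIdeal B, J ≤ I → J.IdealFG → J.toSubSkewBrace.FG

/-! Quotients by ideals. -/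

theorem neg_add_mem_iff (I : BraceIdeal B) (a b : B) : -a + b ∈ I ↔ a⁻¹ * b ∈ I := by
  have h : -a + b = lam a (a⁻¹ * b) := by simp [lam]
  constructor
  · intro hm
    have h2 : a⁻¹ * b = lam a⁻¹ (-a + b) := by rw [h, lam_inv_lam]
    rw [h2]
    exact I.lam_mem' _ hm
  · intro hm
    rw [h]
    exact I.lam_mem' _ hm

theorem normal_toAddSubgroup (I : BraceIdeal B) : I.toAddSubgroup.Normal where
  conj_mem x hx g := by
    rw [← sub_eq_add_neg]
    exact I.add_conj_mem' g hx

theorem normal_toSubgroup (I : BraceIdeal B) : I.toSubSkewBrace.toSubgroup.Normal where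
  conj_mem _ hx g := I.mul_conj_mem' g hx

/-- The underlying set of the quotient skew brace `B / I`: the cosets of `I` in `(B, +)`. -/
def Quot (I : BraceIdeal B) : Type u := B ⧸ I.toAddSubgroup

/-- The canonical map `B → B / I`. -/
def toQuot (I : BraceIdeal B) (b : B) : I.Quot := (QuotientAddGroup.mk b : B ⧸ I.toAddSubgroup)

theorem toQuot_eq_toQuot (I : BraceIdeal B) {a b : B} : I.toQuot a = I.toQuot b ↔ -a + b ∈ I :=
  QuotientAddGroup.eq

theorem toQuot_eq_toQuot' (I : BraceIdeal B) {a b : B} :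
    I.toQuot a = I.toQuot b ↔ (a : B ⧸ I.toSubSkewBrace.toSubgroup) = b := by
  rw [toQuot_eq_toQuot, neg_add_mem_iff, QuotientGroup.eq]
  exact Iff.rfl

theorem toQuot_surjective (I : BraceIdeal B) : Function.Surjective I.toQuot :=
  QuotientAddGroup.mk_surjective

instance (I : BraceIdeal B) : AddGroup I.Quot :=
  letI := I.normal_toAddSubgroup
  inferInstanceAs (AddGroup (B ⧸ I.toAddSubgroup))

instance (I : BraceIdeal B) : Mul I.Quot where
  mul := Quotient.map₂ (· * ·) (by
    intro a a' h b b' h'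
    have := I.normal_toSubgroup
    have e : I.toQuot a = I.toQuot a' := Quotient.sound h
    have e' : I.toQuot b = I.toQuot b' := Quotient.sound h'
    rw [toQuot_eq_toQuot'] at e e'
    refine Quotient.exact (?_ : I.toQuot (a * b) = I.toQuot (a' * b'))
    rw [toQuot_eq_toQuot', QuotientGroup.mk_mul, QuotientGroup.mk_mul, e, e'])

instance (I : BraceIdeal B) : One I.Quot := ⟨I.toQuot 1⟩

instance (I : BraceIdeal B) : Inv I.Quot where
  inv := Quotient.map (·⁻¹) (by
    intro a a' h
    have := I.normal_toSubgroup
    have e : I.toQuot a = I.toQuot a' := Quotient.sound h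
    rw [toQuot_eq_toQuot'] at e
    refine Quotient.exact (?_ : I.toQuot a⁻¹ = I.toQuot a'⁻¹)
    rw [toQuot_eq_toQuot', QuotientGroup.mk_inv, QuotientGroup.mk_inv, e])

theorem toQuot_mul (I : BraceIdeal B) (a b : B) : I.toQuot (a * b) = I.toQuot a * I.toQuot b := rfl

theorem toQuot_add (I : BraceIdeal B) (a b : B) : I.toQuot (a + b) = I.toQuot a + I.toQuot b := rfl

theorem toQuot_neg (I : BraceIdeal B) (a : B) : I.toQuot (-a) = -I.toQuot a := rfl

theorem toQuot_sub (I : BraceIdeal B) (a b : B) : I.toQuot (a - b) = I.toQuot a - I.toQuot b := rfl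

theorem toQuot_zero (I : BraceIdeal B) : I.toQuot 0 = 0 := rfl

theorem toQuot_one (I : BraceIdeal B) : I.toQuot 1 = 1 := rfl

theorem toQuot_inv (I : BraceIdeal B) (a : B) : I.toQuot a⁻¹ = (I.toQuot a)⁻¹ := rfl

instance (I : BraceIdeal B) : Group I.Quot :=
  Group.ofLeftAxioms
    (by
      intro x y z
      obtain ⟨a, rfl⟩ := I.toQuot_surjective x
      obtain ⟨b, rfl⟩ := I.toQuot_surjective y
      obtain ⟨c, rfl⟩ := I.toQuot_surjective z
      simp only [← toQuot_mul, mul_assoc])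
    (by
      intro x
      obtain ⟨a, rfl⟩ := I.toQuot_surjective x
      rw [← toQuot_one, ← toQuot_mul, one_mul])
    (by
      intro x
      obtain ⟨a, rfl⟩ := I.toQuot_surjective x
      rw [← toQuot_inv, ← toQuot_mul, inv_mul_cancel, toQuot_one])

/-- The quotient skew brace `B / I`. -/
instance (I : BraceIdeal B) : SkewBrace I.Quot where
  skew_distrib := by
    intro x y z
    obtain ⟨a, rfl⟩ := I.toQuot_surjective x
    obtain ⟨b, rfl⟩ := I.toQuot_surjective y
    obtain ⟨c, rfl⟩ := I.toQuot_surjective z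
    exact congrArg I.toQuot (skew_distrib a b c)

theorem toQuot_lam (I : BraceIdeal B) (a b : B) : I.toQuot (lam a b) = lam (I.toQuot a) (I.toQuot b) := rfl

theorem toQuot_eq_zero (I : BraceIdeal B) {a : B} : I.toQuot a = 0 ↔ a ∈ I := by
  rw [← toQuot_zero, eq_comm, toQuot_eq_toQuot, neg_zero, zero_add]

/-- The preimage in `B` of an ideal `K` of `B / I`, that is, the ideal `L ⊇ I` of `B` with
`L / I = K`. -/
def comapQuot (I : BraceIdeal B) (K : BraceIdeal I.Quot) : BraceIdeal B where
  carrier := {x | I.toQuot x ∈ K}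
  zero_mem' := K.zero_mem'
  add_mem' := fun ha hb => K.add_mem' ha hb
  neg_mem' := fun ha => K.neg_mem' ha
  lam_mem' := fun a _ hx => K.lam_mem' (I.toQuot a) hx
  add_conj_mem' := fun a _ hx => K.add_conj_mem' (I.toQuot a) hx
  mul_conj_mem' := fun a _ hx => K.mul_conj_mem' (I.toQuot a) hx

theorem le_comapQuot (I : BraceIdeal B) (K : BraceIdeal I.Quot) : I ≤ I.comapQuot K := by
  intro x hx
  change I.toQuot x ∈ K
  rw [I.toQuot_eq_zero.mpr hx]
  exact K.zero_mem'

end BraceIdeal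

namespace SkewBrace

/-- The annihilator `Ann(B) = Ker(λ) ∩ Z(B, +) ∩ Z(B, ∘)`, an ideal of `B`. -/
def annihilator (B : Type u) [SkewBrace B] : BraceIdeal B where
  carrier := {x | x ∈ (lamHom B).ker ∧ x ∈ AddSubgroup.center B ∧ x ∈ Subgroup.center B}
  zero_mem' := by
    refine ⟨?_, zero_mem _, ?_⟩ <;> rw [← one_eq_zero] <;> exact one_mem _
  add_mem' := by
    rintro a b ⟨ha, ha', ha''⟩ ⟨hb, hb', hb''⟩
    have h : a + b = a * b := by
      rw [mul_eq_add_lam, mem_lamHom_ker.mp ha]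
    refine ⟨?_, add_mem ha' hb', ?_⟩ <;> rw [h]
    exacts [mul_mem ha hb, mul_mem ha'' hb'']
  neg_mem' := by
    rintro a ⟨ha, ha', ha''⟩
    have h : -a = a⁻¹ := by
      rw [neg_eq_iff_add_eq_zero, ← one_eq_zero, ← mul_inv_cancel a, mul_eq_add_lam,
        mem_lamHom_ker.mp ha]
    refine ⟨?_, neg_mem ha', ?_⟩ <;> rw [h]
    exacts [inv_mem ha, inv_mem ha'']
  lam_mem' := by
    rintro a x ⟨hx, hx', hx''⟩
    have h : lam a x = x := by
      rw [lam, Subgroup.mem_center_iff.mp hx'' a, mul_eq_add_lam, mem_lamHom_ker.mp hx,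
        ← AddSubgroup.mem_center_iff.mp hx' a, neg_add_cancel_left]
    rw [h]
    exact ⟨hx, hx', hx''⟩
  add_conj_mem' := by
    rintro a x ⟨hx, hx', hx''⟩
    rw [AddSubgroup.mem_center_iff.mp hx' a, add_sub_cancel_right]
    exact ⟨hx, hx', hx''⟩
  mul_conj_mem' := by
    rintro a x ⟨hx, hx', hx''⟩
    rw [Subgroup.mem_center_iff.mp hx'' a, mul_inv_cancel_right]
    exact ⟨hx, hx', hx''⟩

/-- The upper annihilator series: `Ann_0(B) = {0}`, `Ann_{α+1}(B) / Ann_α(B)` is the annihilator of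
`B / Ann_α(B)`, and `Ann_μ(B)` is the union of the `Ann_γ(B)`, `γ < μ`, for `μ` a limit ordinal
(written as the ideal generated by the union; the two agree by `coe_annSeries_limit`). -/
noncomputable def annSeries (B : Type u) [SkewBrace B] (α : Ordinal.{u}) : BraceIdeal B :=
  Ordinal.limitRecOn α ⊥ (fun _ I => I.comapQuot (annihilator I.Quot))
    (fun μ _ f => BraceIdeal.closure (⋃ (γ : Ordinal.{u}) (h : γ < μ), (f γ h : Set B)))

section Series

variable (B : Type u) [SkewBrace B]

theorem annSeries_zero : annSeries B 0 = ⊥ := Ordinal.limitRecOn_zero ..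

theorem annSeries_add_one (α : Ordinal.{u}) : annSeries B (α + 1) =
    (annSeries B α).comapQuot (annihilator (annSeries B α).Quot) :=
  Ordinal.limitRecOn_add_one ..

theorem annSeries_limit {μ : Ordinal.{u}} (hμ : Order.IsSuccLimit μ) : annSeries B μ =
    BraceIdeal.closure (⋃ (γ : Ordinal.{u}) (_ : γ < μ), (annSeries B γ : Set B)) :=
  Ordinal.limitRecOn_limit _ _ _ _ hμ

theorem annSeries_mono : Monotone (annSeries B) := by
  intro α β h
  induction β using Ordinal.limitRecOn with
  | zero => rw [nonpos_iff_eq_zero.mp h]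
  | add_one β ih =>
    rcases h.eq_or_lt with rfl | h
    · exact le_rfl
    · refine (ih (Order.lt_add_one_iff.mp h)).trans ?_
      rw [annSeries_add_one]
      exact BraceIdeal.le_comapQuot _ _
  | limit μ hμ ih =>
    rcases h.eq_or_lt with rfl | h
    · exact le_rfl
    · rw [annSeries_limit B hμ]
      intro x hx I hI
      exact hI (Set.mem_iUnion₂.mpr ⟨α, h, hx⟩)

theorem coe_annSeries_limit {μ : Ordinal.{u}} (hμ : Order.IsSuccLimit μ) :
    (annSeries B μ : Set B) = ⋃ (γ : Ordinal.{u}) (_ : γ < μ), (annSeries B γ : Set B) := by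
  apply Set.Subset.antisymm
  · rw [annSeries_limit B hμ]
    let U : BraceIdeal B :=
      { carrier := ⋃ (γ : Ordinal.{u}) (_ : γ < μ), (annSeries B γ : Set B)
        zero_mem' := Set.mem_iUnion₂.mpr ⟨0, hμ.bot_lt, (annSeries B 0).zero_mem'⟩
        add_mem' := by
          intro a b ha hb
          obtain ⟨γ, hγ, ha⟩ := Set.mem_iUnion₂.mp ha
          obtain ⟨δ, hδ, hb⟩ := Set.mem_iUnion₂.mp hb
          exact Set.mem_iUnion₂.mpr ⟨max γ δ, max_lt hγ hδ, (annSeries B (max γ δ)).add_mem'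
            (annSeries_mono B (le_max_left γ δ) ha) (annSeries_mono B (le_max_right γ δ) hb)⟩
        neg_mem' := by
          intro a ha
          obtain ⟨γ, hγ, ha⟩ := Set.mem_iUnion₂.mp ha
          exact Set.mem_iUnion₂.mpr ⟨γ, hγ, (annSeries B γ).neg_mem' ha⟩
        lam_mem' := by
          intro g a ha
          obtain ⟨γ, hγ, ha⟩ := Set.mem_iUnion₂.mp ha
          exact Set.mem_iUnion₂.mpr ⟨γ, hγ, (annSeries B γ).lam_mem' g ha⟩
        add_conj_mem' := by
          intro g a ha
          obtain ⟨γ, hγ, ha⟩ := Set.mem_iUnion₂.mp ha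
          exact Set.mem_iUnion₂.mpr ⟨γ, hγ, (annSeries B γ).add_conj_mem' g ha⟩
        mul_conj_mem' := by
          intro g a ha
          obtain ⟨γ, hγ, ha⟩ := Set.mem_iUnion₂.mp ha
          exact Set.mem_iUnion₂.mpr ⟨γ, hγ, (annSeries B γ).mul_conj_mem' g ha⟩ }
    intro x hx
    exact hx U (Set.Subset.refl _)
  · intro x hx
    obtain ⟨γ, hγ, hx⟩ := Set.mem_iUnion₂.mp hx
    exact annSeries_mono B hγ.le hx

/-- The upper annihilator length: the smallest ordinal `α` with `Ann_α(B) = Ann_{α+1}(B)`. -/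
noncomputable def annLength : Ordinal.{u} := sInf {α | annSeries B α = annSeries B (α + 1)}

/-- The series does become stationary, so `annLength` is a minimum. -/
theorem annSeries_annLength : annSeries B (annLength B) = annSeries B (annLength B + 1) := by
  refine csInf_mem (s := {α | annSeries B α = annSeries B (α + 1)}) ?_
  by_contra hne
  have hlt : ∀ α, annSeries B α < annSeries B (α + 1) := fun α =>
    (annSeries_mono B (le_add_of_nonneg_right zero_le_one)).lt_of_ne
      fun h => hne ⟨α, h⟩
  have hsm : StrictMono fun α => (annSeries B α : Set B) := by
    intro α β h
    exact SetLike.coe_strictMono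
      ((hlt α).trans_le (annSeries_mono B (Order.add_one_le_of_lt h)))
  exact not_injective_of_ordinal _ hsm.injective

/-- The hyper-annihilator: the last term of the upper annihilator series. -/
noncomputable def hyperAnnihilator : BraceIdeal B := annSeries B (annLength B)

/-- `B` is annihilator nilpotent: `B = Ann_n(B)` for some non-negative integer `n`. -/
def AnnNilpotent : Prop := ∃ n : ℕ, annSeries B n = ⊤

/-- `B` is locally annihilator-nilpotent: every finitely generated sub-skew brace is annihilator
nilpotent. -/
def LocallyAnnNilpotent : Prop := ∀ A : SubSkewBrace B, A.FG → AnnNilpotent A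

/-- `B` is good: it is a good ideal of itself. -/
def IsGoodBrace : Prop := (⊤ : BraceIdeal B).IsGood

end Series

end SkewBrace

/-! The argument rests on the set `obstruction x` of all `lam x b - b`, `b + x - b - x` and `lam b x
- x`: an element lies in `Ann_{α+1}` exactly when its obstructions lie in `Ann_α`. Property (S)
makes this set finite (`finite_obstruction`), so every element of the hyper-annihilator lies in some
`Ann_n` with `n` finite.

For (2) ⇒ (1), a finite subset `F` of `Ann_{n+1}` has finitely many obstructions, all in `Ann_n`. By
induction the ideal they generate is finitely generated as a skew brace; adjoining `F` to it
additively already gives the ideal generated by `F` (`closure_fg_of_subset_annSeries`). The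
statement on `A ∩ I` holds because obstructions computed in `A` are among those computed in `B`.

For (1) ⇒ (2), let `J` be the ideal generated by some `x ∈ I`. Goodness and (S) provide finitely
many elements that generate groups containing `J`, both additively and multiplicatively. A subgroup
of finite index in each group then acts trivially on `J`, so once `A` contains transversals of both
subgroups, elements of `A ∩ J` have the same obstructions in `A` as in `B`
(`exists_finite_obstruction_eq`). Transfinite induction along the series of `A` carries `x` into the
hyper-annihilator of `B`. Part (b) is the case `I = B`, together with the fact that finitely many
generators lie in a common `Ann_n`. -/

theorem Subgroup.exists_finite_transversal {G : Type*} [Group G] (H : Subgroup G)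
    (hH : H.FiniteIndex) : ∃ T : Set G, T.Finite ∧ ∀ b, ∃ t ∈ T, t⁻¹ * b ∈ H := by
  refine ⟨Set.range (fun q : G ⧸ H => q.out), Set.finite_range _, fun b => ?_⟩
  exact ⟨_, ⟨(b : G ⧸ H), rfl⟩, QuotientGroup.eq.mp (QuotientGroup.out_eq' _)⟩

theorem AddSubgroup.exists_finite_transversal {G : Type*} [AddGroup G] (H : AddSubgroup G)
    (hH : H.FiniteIndex) : ∃ T : Set G, T.Finite ∧ ∀ b, ∃ t ∈ T, -t + b ∈ H := by
  refine ⟨Set.range (fun q : G ⧸ H => q.out), Set.finite_range _, fun b => ?_⟩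
  exact ⟨_, ⟨(b : G ⧸ H), rfl⟩, QuotientAddGroup.eq.mp (QuotientAddGroup.out_eq' _)⟩

/-! ### Obstructions and the upper annihilator series. -/

namespace SkewBrace

variable {B : Type u} [SkewBrace B]

theorem mem_fixRight {x b : B} : b ∈ fixRight x ↔ lam x b = b := sub_eq_zero

theorem mem_fixLeft {x b : B} : b ∈ fixLeft x ↔ lam b x = x := sub_eq_zero

theorem lam_apply_one (a : B) : lam a 1 = 1 := by
  rw [one_eq_zero, lam_zero]

theorem add_eq_mul_lam (a b : B) : a + b = a * lam a⁻¹ b := by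
  rw [mul_eq_add_lam, lam_lam_inv]

theorem lam_inv_self (a : B) : lam a a⁻¹ = -a := by
  rw [lam, mul_inv_cancel, one_eq_zero, add_zero]

/-- The action of `λ` on a product. -/
theorem lam_apply_mul (x g h : B) :
    lam x (g * h) = lam x g * lam ((lam x g)⁻¹ * x * g) h := by
  rw [mul_eq_add_lam g h, lam_add, add_eq_mul_lam, ← lam_mul, ← lam_mul, mul_assoc]

/-- The elements that all lie in an ideal `I` exactly when `x` lies in the annihilator of `B`
modulo `I`. -/
def obstruction (x : B) : Set B :=
  (Set.range fun b => lam x b - b) ∪ (Set.range fun b => b + x - b - x) ∪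
    Set.range fun b => lam b x - x

theorem obstruction_subset_iff {x : B} {S : Set B} : obstruction x ⊆ S ↔
    (∀ b, lam x b - b ∈ S) ∧ (∀ b, b + x - b - x ∈ S) ∧ ∀ b, lam b x - x ∈ S := by
  simp only [obstruction, Set.union_subset_iff, Set.range_subset_iff, and_assoc]

theorem obstruction_subset_ideal (I : BraceIdeal B) {x : B} (hx : x ∈ I) :
    obstruction x ⊆ I := by
  rw [obstruction_subset_iff]
  refine ⟨fun b => ?_, fun b => I.toAddSubgroup.sub_mem (I.add_conj_mem' b hx) hx,
    fun b => I.toAddSubgroup.sub_mem (I.lam_mem' b hx) hx⟩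
  -- Modulo `I` the element `x` is the identity, so it acts trivially through `lam`.
  have h0 : I.toQuot x = 1 := by rw [one_eq_zero]; exact I.toQuot_eq_zero.mpr hx
  rw [SetLike.mem_coe, ← I.toQuot_eq_zero, I.toQuot_sub, I.toQuot_lam, h0, lam_one, sub_self]

/-- An element annihilates `B` modulo `I` if and only if its obstructions lie in `I`. -/
theorem mem_comapQuot_annihilator (I : BraceIdeal B) {x : B} :
    x ∈ I.comapQuot (annihilator I.Quot) ↔ obstruction x ⊆ I := by
  have key : ∀ u v : B, u - v ∈ I ↔ I.toQuot u = I.toQuot v := fun u v => by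
    rw [← I.toQuot_eq_zero, I.toQuot_sub, sub_eq_zero]
  have key' : ∀ b, b + x - b - x ∈ I ↔ I.toQuot b + I.toQuot x = I.toQuot x + I.toQuot b := by
    intro b
    rw [key, I.toQuot_sub, I.toQuot_add, sub_eq_iff_eq_add]
  rw [obstruction_subset_iff]
  simp only [SetLike.mem_coe, key']
  simp only [key, I.toQuot_lam]
  change (I.toQuot x ∈ (lamHom I.Quot).ker ∧ I.toQuot x ∈ AddSubgroup.center I.Quot ∧
    I.toQuot x ∈ Subgroup.center I.Quot) ↔ _
  rw [mem_lamHom_ker, AddSubgroup.mem_center_iff, Subgroup.mem_center_iff]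
  simp only [I.toQuot_surjective.forall]
  constructor
  -- Once `x` acts trivially and is additively central modulo `I`, commuting with `b`
  -- multiplicatively amounts to being fixed by `lam b`; hence no multiplicative commutators occur
  -- among the obstructions.
  · rintro ⟨h1, h2, h3⟩
    refine ⟨h1, h2, fun b => ?_⟩
    have := h3 b
    rw [mul_eq_add_lam, mul_eq_add_lam, h1, ← h2] at this
    exact add_left_cancel this
  · rintro ⟨h1, h2, h3⟩
    refine ⟨h1, h2, fun b => ?_⟩
    rw [mul_eq_add_lam, mul_eq_add_lam, h1, h3, h2]

theorem mem_annSeries_add_one {α : Ordinal.{u}} {x : B} :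
    x ∈ annSeries B (α + 1) ↔ obstruction x ⊆ annSeries B α := by
  rw [annSeries_add_one, mem_comapQuot_annihilator]

theorem obstruction_subset_hyperAnnihilator_iff {x : B} :
    obstruction x ⊆ hyperAnnihilator B ↔ x ∈ hyperAnnihilator B := by
  rw [hyperAnnihilator, ← mem_annSeries_add_one, ← annSeries_annLength]

theorem annSeries_le_hyperAnnihilator (α : Ordinal.{u}) : annSeries B α ≤ hyperAnnihilator B := by
  induction α using Ordinal.limitRecOn with
  | zero =>
    exact annSeries_mono B zero_le
  | add_one α ih =>
    intro x hx
    exact obstruction_subset_hyperAnnihilator_iff.mp ((mem_annSeries_add_one.mp hx).trans ih)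
  | limit μ hμ ih =>
    intro x hx
    rw [← SetLike.mem_coe, coe_annSeries_limit B hμ] at hx
    obtain ⟨γ, hγ, hx⟩ := Set.mem_iUnion₂.mp hx
    exact ih γ hγ hx

/-! ### Finiteness consequences of property (S). -/

section PropS

theorem finite_range_lam_apply (hS : PropS B) (x : B) : (Set.range fun b => lam b x).Finite := by
  obtain ⟨T, hT, h⟩ := Subgroup.exists_finite_transversal _ (hS x).2
  refine (hT.image fun b => lam b x).subset ?_
  rintro _ ⟨b, rfl⟩
  obtain ⟨t, ht, hb⟩ := h b
  refine ⟨t, ht, ?_⟩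
  have h1 := congrArg (lam t) (mem_fixLeft.mp hb.1)
  rw [← lam_mul, mul_inv_cancel_left] at h1
  exact h1.symm

/-- Each of the three expressions depends only on the coset of `b` modulo a subgroup that property
(S) makes of finite index. -/
theorem finite_obstruction (hS : PropS B) (x : B) : (obstruction x).Finite := by
  obtain ⟨T, hT, h⟩ := AddSubgroup.exists_finite_transversal _ (hS x).1
  refine (((hT.image fun b => lam x b - b).subset ?_).union
    ((hT.image fun b => b + x - b - x).subset ?_)).union ?_
  · rintro _ ⟨b, rfl⟩
    obtain ⟨t, ht, hb⟩ := h b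
    refine ⟨t, ht, ?_⟩
    obtain ⟨c, rfl⟩ : ∃ c, b = t + c := ⟨-t + b, (add_neg_cancel_left _ _).symm⟩
    rw [neg_add_cancel_left] at hb
    simp only [lam_add, mem_fixRight.mp hb.1, add_sub_add_right_eq_sub]
  · rintro _ ⟨b, rfl⟩
    obtain ⟨t, ht, hb⟩ := h b
    refine ⟨t, ht, ?_⟩
    obtain ⟨c, rfl⟩ : ∃ c, b = t + c := ⟨-t + b, (add_neg_cancel_left _ _).symm⟩
    rw [neg_add_cancel_left] at hb
    have hc : x + c = c + x := AddSubgroup.mem_centralizer_iff.mp hb.2 x rfl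
    simp only [add_assoc, ← hc]
    rw [← add_assoc t x c, add_sub_add_right_eq_sub]
  · have := (finite_range_lam_apply hS x).image fun y => y - x
    rwa [← Set.range_comp] at this

theorem exists_nat_subset_annSeries {F : Set B} (hF : F.Finite)
    (h : ∀ x ∈ F, ∃ n : ℕ, x ∈ annSeries B n) : ∃ n : ℕ, F ⊆ annSeries B n := by
  choose! f hf using h
  obtain ⟨n, hn⟩ := (hF.image f).bddAbove
  exact ⟨n, fun x hx => annSeries_mono B (Nat.cast_le.mpr (hn ⟨x, hx, rfl⟩)) (hf x hx)⟩

/-- Under property (S) the upper annihilator series stops at `ω` at the latest. -/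
theorem exists_nat_mem_annSeries (hS : PropS B) {α : Ordinal.{u}} {x : B}
    (hx : x ∈ annSeries B α) : ∃ n : ℕ, x ∈ annSeries B n := by
  induction α using Ordinal.limitRecOn generalizing x with
  | zero => exact ⟨0, by rwa [Nat.cast_zero]⟩
  | add_one α ih =>
    obtain ⟨n, hn⟩ := exists_nat_subset_annSeries (finite_obstruction hS x)
      fun y hy => ih (mem_annSeries_add_one.mp hx hy)
    exact ⟨n + 1, by rw [Nat.cast_add, Nat.cast_one]; exact mem_annSeries_add_one.mpr hn⟩
  | limit μ hμ ih =>
    rw [← SetLike.mem_coe, coe_annSeries_limit B hμ] at hx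
    obtain ⟨γ, hγ, hx⟩ := Set.mem_iUnion₂.mp hx
    exact ih γ hγ hx

end PropS

end SkewBrace

/-! ### Sub-skew braces: comparison of series, and closures of `λ`-invariant sets. -/

namespace SubSkewBrace

variable {B : Type u} [SkewBrace B]

theorem subset_closure (E : Set B) : E ⊆ closure E := fun _ hx _ hA => hA hx

theorem closure_le {E : Set B} {A : SubSkewBrace B} (h : E ⊆ A) : closure E ≤ A :=
  fun _ hx => hx A h

theorem coe_obstruction_subset (A : SubSkewBrace B) (a : A) :
    Subtype.val '' obstruction a ⊆ obstruction (a : B) := by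
  rintro _ ⟨_, (⟨b, rfl⟩ | ⟨b, rfl⟩) | ⟨b, rfl⟩, rfl⟩
  · exact Or.inl (Or.inl ⟨b, rfl⟩)
  · exact Or.inl (Or.inr ⟨b, rfl⟩)
  · exact Or.inr ⟨b, rfl⟩

/-- Passing to `A` leaves fewer elements `b` to test against, so obstructions can only disappear. -/
theorem mem_annSeries_of_coe_mem (A : SubSkewBrace B) {α : Ordinal.{u}} {a : A}
    (ha : (a : B) ∈ annSeries B α) : a ∈ annSeries A α := by
  induction α using Ordinal.limitRecOn generalizing a with
  | zero =>
    rw [annSeries_zero] at ha ⊢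
    exact Subtype.ext ha
  | add_one α ih =>
    rw [mem_annSeries_add_one] at ha ⊢
    exact fun y hy => ih (ha (A.coe_obstruction_subset a ⟨y, hy, rfl⟩))
  | limit μ hμ ih =>
    rw [← SetLike.mem_coe, coe_annSeries_limit _ hμ] at ha ⊢
    obtain ⟨γ, hγ, ha⟩ := Set.mem_iUnion₂.mp ha
    exact Set.mem_iUnion₂.mpr ⟨γ, hγ, ih γ hγ ha⟩

/-- The additive subgroup generated by a `λ`-invariant set, as a sub-skew brace. -/
def ofAddClosure (E : Set B) (hE : ∀ b, ∀ e ∈ E, lam b e ∈ E) : SubSkewBrace B :=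
  have hlam : ∀ b, ∀ x ∈ AddSubgroup.closure E, lam b x ∈ AddSubgroup.closure E := by
    intro b x hx
    induction hx using AddSubgroup.closure_induction with
    | mem x hx => exact AddSubgroup.subset_closure (hE b x hx)
    | zero => rw [lam_zero]; exact zero_mem _
    | add x y _ _ hx hy => rw [lam_add]; exact add_mem hx hy
    | neg x _ hx => rw [lam_neg]; exact neg_mem hx
  { AddSubgroup.closure E with
    mul_mem' := by
      intro a b ha hb
      rw [mul_eq_add_lam]
      exact add_mem ha (hlam a b hb)
    inv_mem' := by
      intro a ha
      have h := lam_inv_self a⁻¹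
      rw [inv_inv] at h
      rw [← neg_neg a⁻¹, ← h]
      exact neg_mem (hlam _ _ ha) }

/-- The multiplicative subgroup generated by a `λ`-invariant set, as a sub-skew brace. -/
def ofMulClosure (E : Set B) (hE : ∀ b, ∀ e ∈ E, lam b e ∈ E) : SubSkewBrace B :=
  -- The quantifier over `b` stays inside the induction because `lam_apply_mul` changes the acting
  -- element on the second factor.
  have hlam : ∀ x ∈ Subgroup.closure E, ∀ b, lam b x ∈ Subgroup.closure E := by
    intro x hx
    induction hx using Subgroup.closure_induction with
    | mem x hx => exact fun b => Subgroup.subset_closure (hE b x hx)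
    | one => intro b; rw [lam_apply_one]; exact one_mem _
    | mul x y _ _ hx hy => intro b; rw [lam_apply_mul]; exact mul_mem (hx _) (hy _)
    | inv x _ hx =>
      intro b
      have h := lam_apply_mul b x⁻¹ x
      rw [inv_mul_cancel, lam_apply_one] at h
      rw [eq_inv_of_mul_eq_one_left h.symm]
      exact inv_mem (hx _)
  { carrier := Subgroup.closure E
    zero_mem' := by rw [← one_eq_zero]; exact one_mem _
    add_mem' := by
      intro a b ha hb
      rw [add_eq_mul_lam]
      exact mul_mem ha (hlam b hb _)
    neg_mem' := by
      intro a ha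
      rw [← lam_inv_self]
      exact hlam _ (inv_mem ha) _
    mul_mem' := fun ha hb => mul_mem ha hb
    inv_mem' := fun ha => inv_mem ha }

end SubSkewBrace

/-! ### Finite generation of ideals. -/

namespace BraceIdeal

variable {B : Type u} [SkewBrace B]

theorem subset_closure (E : Set B) : E ⊆ closure E := fun _ hx _ hA => hA hx

theorem closure_le {E : Set B} {I : BraceIdeal B} (h : E ⊆ I) : closure E ≤ I :=
  fun _ hx => hx I h

/-- Under property (S), an ideal that is finitely generated as a skew brace has finitely generated
additive and multiplicative groups. -/
theorem exists_finite_generators (hS : PropS B) {J : BraceIdeal B} (hJ : J.toSubSkewBrace.FG) :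
    ∃ E : Set B, E.Finite ∧ ∀ j ∈ J, j ∈ AddSubgroup.closure E ∧ j ∈ Subgroup.closure E := by
  obtain ⟨F, hF, hFJ⟩ := hJ
  -- The union of the `λ`-orbits of the generators is finite by (S) and `λ`-invariant, so its
  -- additive and its multiplicative closure are both sub-skew braces, and each contains `J`.
  let E : Set B := ⋃ x ∈ F, Set.range fun b => lam b x
  have hE : ∀ b, ∀ e ∈ E, lam b e ∈ E := by
    intro b e he
    obtain ⟨x, hx, c, rfl⟩ := Set.mem_iUnion₂.mp he
    exact Set.mem_iUnion₂.mpr ⟨x, hx, b * c, lam_mul b c x⟩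
  have hFE : F ⊆ E := fun x hx => Set.mem_iUnion₂.mpr ⟨x, hx, 1, lam_one x⟩
  refine ⟨E, hF.biUnion fun x _ => finite_range_lam_apply hS x, fun j hj => ?_⟩
  have hj' : j ∈ SubSkewBrace.closure F := by rw [hFJ]; exact hj
  exact ⟨SubSkewBrace.closure_le (A := .ofAddClosure E hE)
      (hFE.trans AddSubgroup.subset_closure) hj',
    SubSkewBrace.closure_le (A := .ofMulClosure E hE)
      (hFE.trans Subgroup.subset_closure) hj'⟩

/-- An additive subgroup between `I` and the preimage of the annihilator of `B / I` is an ideal. -/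
def ofBetween (I : BraceIdeal B) (W : AddSubgroup B) (hIW : ∀ x ∈ I, x ∈ W)
    (hW : ∀ x ∈ W, obstruction x ⊆ I) : BraceIdeal B :=
  have hlam : ∀ a, ∀ x ∈ W, lam a x ∈ W := by
    intro a x hx
    rw [← sub_add_cancel (lam a x) x]
    exact add_mem (hIW _ ((obstruction_subset_iff.mp (hW x hx)).2.2 a)) hx
  have hconj : ∀ a, ∀ x ∈ W, a + x - a ∈ W := by
    intro a x hx
    rw [← sub_add_cancel (a + x - a) x]
    exact add_mem (hIW _ ((obstruction_subset_iff.mp (hW x hx)).2.1 a)) hx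
  { W with
    lam_mem' := fun a _ hx => hlam a _ hx
    add_conj_mem' := fun a _ hx => hconj a _ hx
    mul_conj_mem' := by
      intro a x hx
      have h := hIW _ ((obstruction_subset_iff.mp (hW x hx)).1 a⁻¹)
      -- A multiplicative conjugate is an additive conjugate of the `lam a`-image of `x` modified by
      -- an obstruction of `x`; this uses `-a = lam a a⁻¹`.
      have e : a * x * a⁻¹ = a + lam a (x + (lam x a⁻¹ - a⁻¹)) - a := by
        rw [mul_assoc, mul_eq_add_lam a, mul_eq_add_lam x, sub_eq_add_neg _ a, ← lam_inv_self a,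
          add_assoc, ← lam_add, add_assoc x, sub_add_cancel]
      rw [e]
      exact hconj a _ (hlam a _ (add_mem hx h)) }

theorem closure_fg_of_subset_annSeries (hS : PropS B) (n : ℕ) {F : Set B} (hF : F.Finite)
    (hFn : F ⊆ annSeries B n) : (closure F).toSubSkewBrace.FG := by
  induction n generalizing F with
  | zero =>
    refine ⟨∅, Set.finite_empty, le_antisymm (SubSkewBrace.closure_le (Set.empty_subset _)) ?_⟩
    rw [Nat.cast_zero, annSeries_zero] at hFn
    intro x hx
    obtain rfl : x = 0 := closure_le hFn hx
    exact (SubSkewBrace.closure ∅).zero_mem'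
  | succ n ih =>
    rw [Nat.cast_add, Nat.cast_one] at hFn
    -- Modulo the ideal generated by `F'`, all of `F` lies in the annihilator, where every additive
    -- subgroup is an ideal.
    let F' : Set B := ⋃ x ∈ F, obstruction x
    obtain ⟨E, hE, hEJ⟩ := ih (F := F') (hF.biUnion fun x _ => finite_obstruction hS x)
      (Set.iUnion₂_subset fun x hx => mem_annSeries_add_one.mp (hFn hx))
    have hJ : closure F' ≤ closure F := closure_le <| Set.iUnion₂_subset fun x hx =>
      obstruction_subset_ideal _ (subset_closure F hx)
    refine ⟨F ∪ E, hF.union hE, le_antisymm (SubSkewBrace.closure_le ?_) ?_⟩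
    · refine Set.union_subset (subset_closure F) fun x hx => hJ ?_
      have hx' := SubSkewBrace.subset_closure E hx
      rw [hEJ] at hx'
      exact hx'
    -- `W` is an ideal by `ofBetween`, so it contains `closure F`; being generated additively, it
    -- lies in the sub-skew brace generated by `F ∪ E`.
    · let W : AddSubgroup B := AddSubgroup.closure (F ∪ closure F')
      have hW : ∀ x ∈ W, obstruction x ⊆ closure F' := by
        intro x hx
        rw [← mem_comapQuot_annihilator]
        refine (AddSubgroup.closure_le (comapQuot (closure F') (annihilator _)).toAddSubgroup).mpr
          (Set.union_subset (fun y hy => ?_) (le_comapQuot _ _)) hx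
        exact (mem_comapQuot_annihilator _).mpr
          ((Set.subset_biUnion_of_mem (u := obstruction) hy).trans (subset_closure F'))
      have h1 : closure F ≤ ofBetween (closure F') W
          (fun x hx => AddSubgroup.subset_closure (Or.inr hx)) hW :=
        closure_le fun x hx => AddSubgroup.subset_closure (Or.inl hx)
      have h2 : W ≤ (SubSkewBrace.closure (F ∪ E)).toAddSubgroup := by
        refine (AddSubgroup.closure_le _).mpr (Set.union_subset ?_ fun x hx => ?_)
        · exact Set.subset_union_left.trans (SubSkewBrace.subset_closure _)
        · have hx' : x ∈ SubSkewBrace.closure E := by rw [hEJ]; exact hx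
          exact SubSkewBrace.closure_le
            (Set.subset_union_right.trans (SubSkewBrace.subset_closure _)) hx'
      exact fun x hx => h2 (h1 hx)

theorem isGood_of_le_hyperAnnihilator (hS : PropS B) {I : BraceIdeal B}
    (hI : I ≤ hyperAnnihilator B) : I.IsGood := by
  rintro J hJI ⟨F, hF, rfl⟩
  obtain ⟨n, hn⟩ := exists_nat_subset_annSeries hF fun x hx =>
    exists_nat_mem_annSeries hS (hI (hJI (subset_closure F hx)))
  exact closure_fg_of_subset_annSeries hS n hF hn

/-! ### From finitely generated sub-skew braces to the whole skew brace. -/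

/-- For an ideal `J` that is finitely generated as a skew brace, finitely many elements of `B`
suffice to control the obstructions of all elements of `J`. -/
theorem exists_finite_obstruction_eq (hS : PropS B) {J : BraceIdeal B}
    (hJ : J.toSubSkewBrace.FG) : ∃ T : Set B, T.Finite ∧ ∀ A : SubSkewBrace B, T ⊆ A →
      ∀ y : A, (y : B) ∈ J → obstruction (y : B) ⊆ Subtype.val '' obstruction y := by
  obtain ⟨E, hE, hEJ⟩ := exists_finite_generators hS hJ
  have : Finite E := hE
  obtain ⟨T, hT, hTB⟩ := AddSubgroup.exists_finite_transversal
    (⨅ e : E, fixRight (e : B) ⊓ AddSubgroup.centralizer {(e : B)})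
    (AddSubgroup.finiteIndex_iInf fun e => (hS e).1)
  obtain ⟨T', hT', hTB'⟩ := Subgroup.exists_finite_transversal
    (⨅ e : E, fixLeft (e : B) ⊓ Subgroup.centralizer {(e : B)})
    (Subgroup.finiteIndex_iInf fun e => (hS e).2)
  refine ⟨T ∪ T', hT.union hT', fun A hA y hy => ?_⟩
  -- For fixed `c`, the `y` with `lam y c = c` form a multiplicative subgroup, while those commuting
  -- additively with `c` form an additive one; hence both kinds of generation of `J` by `E` are
  -- needed.
  have hadd : ∀ b, ∃ a ∈ A, ∃ c, b = a + c ∧ lam (y : B) c = c ∧ c + y = y + c := by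
    intro b
    obtain ⟨t, ht, hc⟩ := hTB b
    refine ⟨t, hA (Or.inl ht), -t + b, (add_neg_cancel_left _ _).symm, ?_, ?_⟩
    · have h : Subgroup.closure E ≤ fixLeft (-t + b) := (Subgroup.closure_le _).mpr fun e he =>
        mem_fixLeft.mpr (mem_fixRight.mp (AddSubgroup.mem_iInf.mp hc ⟨e, he⟩).1)
      exact mem_fixLeft.mp (h (hEJ y hy).2)
    · have h : AddSubgroup.closure E ≤ AddSubgroup.centralizer {-t + b} := by
        refine (AddSubgroup.closure_le _).mpr fun e he => ?_
        refine AddSubgroup.mem_centralizer_iff.mpr ?_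
        rintro _ rfl
        exact (AddSubgroup.mem_centralizer_iff.mp
          (AddSubgroup.mem_iInf.mp hc ⟨e, he⟩).2 e rfl).symm
      exact AddSubgroup.mem_centralizer_iff.mp (h (hEJ y hy).1) _ rfl
  have hmul : ∀ b, ∃ a ∈ A, lam b (y : B) = lam a y := by
    intro b
    obtain ⟨t, ht, hc⟩ := hTB' b
    refine ⟨t, hA (Or.inr ht), ?_⟩
    have h : AddSubgroup.closure E ≤ fixRight (t⁻¹ * b) := (AddSubgroup.closure_le _).mpr
      fun e he => mem_fixRight.mpr (mem_fixLeft.mp (Subgroup.mem_iInf.mp hc ⟨e, he⟩).1)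
    conv_rhs => rw [← mem_fixRight.mp (h (hEJ y hy).1)]
    rw [← lam_mul, mul_inv_cancel_left]
  rw [obstruction_subset_iff]
  refine ⟨fun b => ?_, fun b => ?_, fun b => ?_⟩
  · obtain ⟨a, ha, c, rfl, h, -⟩ := hadd b
    exact ⟨_, Or.inl (Or.inl ⟨⟨a, ha⟩, rfl⟩), by
      rw [lam_add, h, add_sub_add_right_eq_sub]; rfl⟩
  · obtain ⟨a, ha, c, rfl, -, h⟩ := hadd b
    exact ⟨_, Or.inl (Or.inr ⟨⟨a, ha⟩, rfl⟩), by
      rw [add_assoc, h, ← add_assoc, add_sub_add_right_eq_sub]; rfl⟩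
  · obtain ⟨a, ha, h⟩ := hmul b
    exact ⟨_, Or.inr ⟨⟨a, ha⟩, rfl⟩, by rw [h]; rfl⟩

theorem le_hyperAnnihilator_of_isGood (hS : PropS B) {I : BraceIdeal B} (hI : I.IsGood)
    (h : ∀ A : SubSkewBrace B, A.FG → ∀ a : A, (a : B) ∈ I → a ∈ hyperAnnihilator A) :
    I ≤ hyperAnnihilator B := by
  intro x hx
  have hJI : closure {x} ≤ I := closure_le (Set.singleton_subset_iff.mpr hx)
  have hxJ : x ∈ closure {x} := subset_closure {x} rfl
  obtain ⟨T, hT, hTA⟩ := exists_finite_obstruction_eq hS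
    (hI _ hJI ⟨{x}, Set.finite_singleton x, rfl⟩)
  -- `T` makes obstructions in `A` and in `B` agree on `J`, and `x` is added so that the hypothesis
  -- on `A` applies to it.
  let A := SubSkewBrace.closure (insert x T)
  have hsub : insert x T ⊆ (A : Set B) := SubSkewBrace.subset_closure _
  have hTA' := hTA A ((Set.subset_insert x T).trans hsub)
  -- Membership in the ideal generated by `x` is carried along because the choice of `T` controls
  -- only that ideal; obstructions of its elements stay inside it.
  have key : ∀ α : Ordinal.{u}, ∀ y : A, (y : B) ∈ closure {x} → y ∈ annSeries A α →
      (y : B) ∈ hyperAnnihilator B := by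
    intro α
    induction α using Ordinal.limitRecOn with
    | zero =>
      intro y _ hy
      rw [annSeries_zero] at hy
      obtain rfl : y = 0 := hy
      exact (hyperAnnihilator B).zero_mem'
    | add_one α ih =>
      intro y hyJ hy
      rw [← obstruction_subset_hyperAnnihilator_iff]
      intro z hz
      obtain ⟨w, hw, rfl⟩ := hTA' y hyJ hz
      exact ih w (obstruction_subset_ideal _ hyJ hz) (mem_annSeries_add_one.mp hy hw)
    | limit μ hμ ih =>
      intro y hyJ hy
      rw [← SetLike.mem_coe, coe_annSeries_limit _ hμ] at hy
      obtain ⟨γ, hγ, hy⟩ := Set.mem_iUnion₂.mp hy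
      exact ih γ hγ y hyJ hy
  exact key _ ⟨x, hsub (Set.mem_insert x T)⟩ hxJ
    (h A ⟨_, hT.insert x, rfl⟩ ⟨x, hsub (Set.mem_insert x T)⟩ hx)

end BraceIdeal

/-! ### Local annihilator nilpotency and the main theorem. -/

namespace SkewBrace

variable {B : Type u} [SkewBrace B]

theorem locallyAnnNilpotent_of_hyperAnnihilator_eq_top (hS : PropS B)
    (h : hyperAnnihilator B = ⊤) : LocallyAnnNilpotent B := by
  rintro A ⟨E, hE, rfl⟩
  -- The finitely many generators share one `Ann_n(B)`; as an ideal it is a sub-skew brace, so it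
  -- contains all of `A`.
  obtain ⟨n, hn⟩ := exists_nat_subset_annSeries hE fun x _ =>
    exists_nat_mem_annSeries hS (show x ∈ hyperAnnihilator B by rw [h]; trivial)
  refine ⟨n, le_antisymm (fun _ _ => trivial) fun a _ => ?_⟩
  exact SubSkewBrace.mem_annSeries_of_coe_mem _
    (SubSkewBrace.closure_le (A := (annSeries B n).toSubSkewBrace) hn a.2)

end SkewBrace

/-- Let `B` be a skew brace with property (S). An ideal `I` of `B` is good and satisfies
`A ∩ I ⊆ hyperAnnihilator A` for all finitely generated sub-skew braces `A` if and only if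
`I` is contained in the hyper-annihilator of `B`. If moreover `B` is good, then `B` is locally
annihilator-nilpotent if and only if it equals its hyper-annihilator. -/
theorem mainTheorem12 {B : Type u} [SkewBrace B] (hS : PropS B) :
    (∀ I : BraceIdeal B,
      (I.IsGood ∧ ∀ A : SubSkewBrace B, A.FG → ∀ a : A, (a : B) ∈ I → a ∈ hyperAnnihilator A) ↔
        I ≤ hyperAnnihilator B) ∧
    (IsGoodBrace B → (LocallyAnnNilpotent B ↔ hyperAnnihilator B = ⊤)) := by
  refine ⟨fun I => ⟨fun h => BraceIdeal.le_hyperAnnihilator_of_isGood hS h.1 h.2, fun h =>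
    ⟨BraceIdeal.isGood_of_le_hyperAnnihilator hS h, fun A _ a ha => ?_⟩⟩, fun hB =>
    ⟨fun h => ?_, locallyAnnNilpotent_of_hyperAnnihilator_eq_top hS⟩⟩
  · exact annSeries_le_hyperAnnihilator _ (A.mem_annSeries_of_coe_mem (h ha))
  · refine le_antisymm (fun _ _ => trivial)
      (BraceIdeal.le_hyperAnnihilator_of_isGood hS hB fun A hA a _ => ?_)
    obtain ⟨n, hn⟩ := h A hA
    exact annSeries_le_hyperAnnihilator n (by rw [hn]; trivial)
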